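/- Let $(c_n)_{n\ge -1}$ be defined by $c_{-1}=0$, $c_0=1$ and $$n^2c_{n-1}+(17n^2+17n+6)\,c_n+72(n+1)^2c_{n+1}=0\qquad(n\ge 0),$$ and let $h_6(z)=\sum_{n\ge0}c_nz^n$. This power series converges in a neighborhood of $0\in\mathbb{C}$, and $h_6$ is equivalently defined there by $$h_6(z)=\Bigl[\tfrac{1}{2^{12}3^6}(z+6)^3(z^3+18z^2+84z+24)^3\Bigr]^{-1/12}\,{}_2F_1\Bigl(\tfrac1{12},\tfrac5{12};1;\tfrac{1728\,z(z+9)^2(z+8)^3}{(z+6)^3(z^3+18z^2+84z+24)^3}\Bigr)$$ and by $h_6(z)=\mathit{Hl}\bigl(\tfrac98,\tfrac34;1,1,1,1;-z/8\bigr)$. Here $\mathit{Hl}(a,q;\alpha,\beta,\gamma,\delta;\cdot)$ denotes the local Heun function, i.e., the unique function $f$ that is analytic at $0$, satisfies $f(0)=1$, and solves near $0$ the equation $$f''+\Bigl[\tfrac{\gamma}{x}+\tfrac{\delta}{x-1}+\tfrac{\alpha+\beta-\gamma-\delta+1}{x-a}\Bigr]f'+\tfrac{\alpha\beta x-q}{x(x-1)(x-a)}\,f=0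 ;$$ for the stated parameters such a function exists and is unique near $0$. Let the algebraic functions $z=z(t)$, $z'=z'(t)$ be defined implicitly in a neighborhood of $t=\infty\in\mathbb{P}^1(\mathbb{C})$ by $$z+\frac{72}{z'}=(t-2)(t^5-10t^4+28t^3-26t^2+20t+4),\qquad z\cdot\frac{72}{z'}=72\,t(t-2)^2(t^2-t+1),$$ on the branch for which $z,z'\to0$ as $t\to\infty$; this branch exists, is analytic for all sufficiently large $|t|$, and is unique near $\infty$. Then for all $t\in\mathbb{C}$ with $|t|$ sufficiently large, $$h_6(z(t))=6\left\{\frac{z(t)^6}{z'(t)}\cdot\frac{[z(t)+9]^3}{[z'(t)+9]^2}\cdot\frac{[z(t)+8]^2}{[z'(t)+8]^3}\right\}^{-1/12}h_6(z'(t)).$$ The powers $-1/12$ are principal values. -/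

import Mathlib

open Filter Topology Bornology

noncomputable section

/-- The coefficients `c n` of `h₆`. With `c (-1) = 0` and `c 0 = 1` they satisfy
`n² c (n-1) + (17 n² + 17 n + 6) c n + 72 (n+1)² c (n+1) = 0`, solved here for `c (n+1)`. -/
def h6Coeff : ℕ → ℂ
  | 0 => 1
  | 1 => -6 / 72
  | n + 2 =>
      -(((n : ℂ) + 1) ^ 2 * h6Coeff n
        + (17 * ((n : ℂ) + 1) ^ 2 + 17 * ((n : ℂ) + 1) + 6) * h6Coeff (n + 1))
        / (72 * ((n : ℂ) + 2) ^ 2)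

/-- The three-term recurrence, for every `n ≥ 0`, with `c (-1) = 0`. -/
theorem h6Coeff_recurrence (n : ℕ) :
    (n : ℂ) ^ 2 * (if n = 0 then 0 else h6Coeff (n - 1))
      + (17 * (n : ℂ) ^ 2 + 17 * (n : ℂ) + 6) * h6Coeff n
      + 72 * ((n : ℂ) + 1) ^ 2 * h6Coeff (n + 1) = 0 := by
  rcases n with _ | n
  · norm_num [h6Coeff]
  · have h : (n : ℂ) + 2 ≠ 0 := by exact_mod_cast (by omega : n + 2 ≠ 0)
    have e : (n : ℂ) + 1 + 1 = n + 2 := by ring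
    simp only [Nat.add_sub_cancel, Nat.succ_ne_zero, if_false, h6Coeff]
    push_cast
    rw [e]
    field_simp
    ring

/-- `h₆ z = ∑ c n * z ^ n`. -/
def h6 (z : ℂ) : ℂ := ∑' n : ℕ, h6Coeff n * z ^ n

/-- `f` is (a representative of the germ at `0` of) the local Heun function
`Hl (a, q; α, β, γ, δ; ·)`: it is analytic at `0`, has value `1` there, and near `0` it satisfies
Heun's equation with the singular points `0`, `1`, `a`, `∞`, where `ε = α + β - γ - δ + 1`. -/
def IsLocalHeun (a q α β γ δ : ℂ) (f : ℂ → ℂ) : Prop :=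
  AnalyticAt ℂ f 0 ∧ f 0 = 1 ∧
    ∀ᶠ x in 𝓝[≠] (0 : ℂ),
      deriv (deriv f) x
        + (γ / x + δ / (x - 1) + (α + β - γ - δ + 1) / (x - a)) * deriv f x
        + (α * β * x - q) / (x * (x - 1) * (x - a)) * f x = 0

/-- `z` and `z'` represent the branch, near `t = ∞` and tending to `0` there, of the pair of
algebraic functions defined implicitly by the formulas for `z + 72 / z'` and `z * (72 / z')`.
The punctured neighbourhoods of `∞` in `ℂ` form the filter `cobounded ℂ`. -/
def IsBranchAtInfinity (z z' : ℂ → ℂ) : Prop :=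
  Tendsto z (cobounded ℂ) (𝓝 0) ∧ Tendsto z' (cobounded ℂ) (𝓝 0) ∧
    ∀ᶠ t in cobounded ℂ, z' t ≠ 0 ∧
      z t + 72 / z' t = (t - 2) * (t ^ 5 - 10 * t ^ 4 + 28 * t ^ 3 - 26 * t ^ 2 + 20 * t + 4) ∧
      z t * (72 / z' t) = 72 * t * (t - 2) ^ 2 * (t ^ 2 - t + 1)

end

/-! The recurrence makes `h6` a solution of a Fuchsian equation that is singular at `0`. An analytic
solution there is determined by its value at `0` (`SolvesH6.eventuallyEq`). Every other description
of `h6` is therefore proved by checking the equation and the value at `0`. This gives the Heun form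
(`isLocalHeun_iff`) and, through the pullback criterion `h6_eventuallyEq_pullback`, two expressions
of `h6` as a prefactor times the same `₂F₁`, related by `z ↦ 72 / z`.

For the functional equation, the Fricke expression is used at `z` and the given one at `z'`. By
`modular_invariant_eq` the two hypergeometric arguments coincide, so `h6 (z t)` and `h6 (z' t)`
differ only by the ratio of the prefactors. The same identity turns that ratio into the stated
bracket, and comparing the normalizations at `0` produces the factor `6`. The parameter `t`
determines only the sum and product of `z` and `72 / z'`, so the algebra is done with symmetric
functions of these two. -/

/-! ### Power series and three-term recurrences -/

/-- Termwise differentiation, in Euler form, of a power series with coefficients in the closed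
unit disc. -/
theorem hasSum_euler_derivatives {c : ℕ → ℂ} (hc : ∀ n, ‖c n‖ ≤ 1) {f : ℂ → ℂ}
    (hf : ∀ z, f z = ∑' n, c n * z ^ n) {z : ℂ} (hz : ‖z‖ < 1) :
    AnalyticAt ℂ f z ∧ HasSum (fun n => c n * z ^ n) (f z) ∧
      HasSum (fun n : ℕ => (n : ℂ) * (c n * z ^ n)) (z * deriv f z) ∧
      HasSum (fun n : ℕ => (n : ℂ) * ((n : ℂ) - 1) * (c n * z ^ n))
        (z ^ 2 * deriv (deriv f) z) := by
  -- On a ball of radius `r < 1` around `0` the terms and their derivatives have summable majorants.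
  obtain ⟨r, hzr, hr1⟩ := exists_between hz
  have hr0 : 0 ≤ r := (norm_nonneg z).trans hzr.le
  have hU : IsOpen (Metric.ball (0 : ℂ) r) := Metric.isOpen_ball
  have hzU : z ∈ Metric.ball (0 : ℂ) r := by simpa using hzr
  have hs0 : Summable fun n : ℕ => r ^ n := summable_geometric_of_lt_one hr0 hr1
  have hs1 : Summable fun n : ℕ => (n : ℝ) * r ^ (n - 1) := by
    rw [← summable_nat_add_iff 1]
    have h1 : Summable fun n : ℕ => (n : ℝ) ^ 1 * r ^ n :=
      summable_pow_mul_geometric_of_norm_lt_one 1 (by rwa [Real.norm_of_nonneg hr0])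
    refine (h1.add hs0).congr fun n => ?_
    simp only [Nat.add_sub_cancel]
    push_cast
    ring
  have hb0 : ∀ (n : ℕ) (w : ℂ), w ∈ Metric.ball (0 : ℂ) r → ‖c n * w ^ n‖ ≤ r ^ n := by
    intro n w hw
    have hw' : ‖w‖ ≤ r := by simpa using (Metric.mem_ball.1 hw).le
    calc ‖c n * w ^ n‖ = ‖c n‖ * ‖w‖ ^ n := by rw [norm_mul, norm_pow]
      _ ≤ 1 * r ^ n := by gcongr; exact hc n
      _ = r ^ n := one_mul _
  have hb1 : ∀ (n : ℕ) (w : ℂ), w ∈ Metric.ball (0 : ℂ) r →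
      ‖c n * ((n : ℂ) * w ^ (n - 1))‖ ≤ (n : ℝ) * r ^ (n - 1) := by
    intro n w hw
    have hw' : ‖w‖ ≤ r := by simpa using (Metric.mem_ball.1 hw).le
    calc ‖c n * ((n : ℂ) * w ^ (n - 1))‖ = ‖c n‖ * ((n : ℝ) * ‖w‖ ^ (n - 1)) := by
          rw [norm_mul, norm_mul, norm_pow, Complex.norm_natCast]
      _ ≤ 1 * ((n : ℝ) * r ^ (n - 1)) := by gcongr; exact hc n
      _ = _ := one_mul _
  have hd0 : ∀ (n : ℕ) (w : ℂ), HasDerivAt (fun w => c n * w ^ n)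
      (c n * ((n : ℂ) * w ^ (n - 1))) w :=
    fun n w => (hasDerivAt_pow n w).const_mul (c n)
  have hd1 : ∀ (n : ℕ) (w : ℂ), HasDerivAt (fun w => c n * ((n : ℂ) * w ^ (n - 1)))
      (c n * ((n : ℂ) * (((n - 1 : ℕ) : ℂ) * w ^ (n - 1 - 1)))) w :=
    fun n w => ((hasDerivAt_pow (n - 1) w).const_mul (n : ℂ)).const_mul (c n)
  have hfe : f = fun w => ∑' n, c n * w ^ n := funext hf
  have hdiff : DifferentiableOn ℂ f (Metric.ball 0 r) := by
    rw [hfe]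
    exact Complex.differentiableOn_tsum_of_summable_norm hs0
      (fun n w _ => (hd0 n w).differentiableAt.differentiableWithinAt) hU hb0
  have hderiv : ∀ w ∈ Metric.ball (0 : ℂ) r,
      HasSum (fun n => c n * ((n : ℂ) * w ^ (n - 1))) (deriv f w) := by
    intro w hw
    have := Complex.hasSum_deriv_of_summable_norm hs0
      (fun n w _ => (hd0 n w).differentiableAt.differentiableWithinAt) hU hb0 hw
    rw [hfe]
    simpa only [(hd0 _ w).deriv] using this
  have hderiv2 : HasSum (fun n => c n * ((n : ℂ) * (((n - 1 : ℕ) : ℂ) * z ^ (n - 1 - 1))))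
      (deriv (deriv f) z) := by
    have := Complex.hasSum_deriv_of_summable_norm hs1
      (fun n w _ => (hd1 n w).differentiableAt.differentiableWithinAt) hU hb1 hzU
    have he : deriv f =ᶠ[𝓝 z] fun w => ∑' n, c n * ((n : ℂ) * w ^ (n - 1)) := by
      filter_upwards [hU.mem_nhds hzU] with w hw using (hderiv w hw).tsum_eq.symm
    rw [he.deriv_eq]
    simpa only [(hd1 _ z).deriv] using this
  refine ⟨hdiff.analyticAt (hU.mem_nhds hzU), ?_, ?_, ?_⟩
  · rw [hf z]
    exact (Summable.of_norm_bounded hs0 fun n => hb0 n z hzU).hasSum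
  · refine ((hderiv z hzU).mul_left z).congr_fun ?_
    rintro (_ | n)
    · simp
    · simp only [Nat.add_sub_cancel]
      ring
  · refine (hderiv2.mul_left (z ^ 2)).congr_fun ?_
    rintro (_ | _ | n)
    · simp
    · simp
    · simp only [Nat.add_sub_cancel]
      push_cast
      ring

/-- A three-term recurrence for the coefficients gives a second-order differential equation. -/
theorem ode_of_recurrence {c : ℕ → ℂ} (hc : ∀ n, ‖c n‖ ≤ 1) {f : ℂ → ℂ}
    (hf : ∀ z, f z = ∑' n, c n * z ^ n) {κ α₁ β₁ γ₁ α₂ β₂ γ₂ : ℂ}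
    (h1 : κ * c 1 + γ₁ * c 0 = 0)
    (h2 : ∀ n : ℕ, κ * ((n : ℂ) + 2) ^ 2 * c (n + 2)
      + (α₁ * (((n : ℂ) + 1) * n) + β₁ * ((n : ℂ) + 1) + γ₁) * c (n + 1)
      + (α₂ * ((n : ℂ) * ((n : ℂ) - 1)) + β₂ * n + γ₂) * c n = 0)
    {z : ℂ} (hz : ‖z‖ < 1) :
    (κ + α₁ * z + α₂ * z ^ 2) * (z ^ 2 * deriv (deriv f) z)
      + (κ + β₁ * z + β₂ * z ^ 2) * (z * deriv f z) + (γ₁ * z + γ₂ * z ^ 2) * f z = 0 := by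
  obtain ⟨-, s0, s1, s2⟩ := hasSum_euler_derivatives hc hf hz
  have hA := (s2.mul_left κ).add (s1.mul_left κ)
  have hB := ((s2.mul_left α₁).add (s1.mul_left β₁)).add (s0.mul_left γ₁)
  have hC := ((s2.mul_left α₂).add (s1.mul_left β₂)).add (s0.mul_left γ₂)
  -- Dropping two terms of the first series and one of the second aligns all three at `z ^ (n + 2)`.
  -- Their sum is then termwise the recurrence.
  have hA' := (hasSum_nat_add_iff' 2).2 hA
  have hB' := ((hasSum_nat_add_iff' 1).2 hB).mul_left z
  have hT := (hA'.add hB').add (hC.mul_left (z ^ 2))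
  have h0 : HasSum (fun _ : ℕ => (0 : ℂ)) _ := hT.congr_fun fun n => by
    have := h2 n
    push_cast
    linear_combination (-z ^ (n + 2)) * this
  have := h0.unique hasSum_zero
  simp only [Finset.sum_range_succ, Finset.sum_range_zero] at this
  norm_num at this
  -- The dropped terms add up to `z * (κ * c 1 + γ₁ * c 0)`, which is why `h1` is a separate
  -- hypothesis.
  linear_combination this + z * h1

/-- Since `18 (n+1)² + 17 (n+1) + 6 ≤ 72 (n+2)²`, two consecutive coefficients in the unit disc
force the next one into it. The bound is crude, but only convergence near `0` is needed. -/
theorem norm_h6Coeff_le_one (n : ℕ) : ‖h6Coeff n‖ ≤ 1 := by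
  suffices h : ∀ n, ‖h6Coeff n‖ ≤ 1 ∧ ‖h6Coeff (n + 1)‖ ≤ 1 from (h n).1
  intro n
  induction n with
  | zero => constructor <;> norm_num [h6Coeff]
  | succ n ih =>
    refine ⟨ih.2, ?_⟩
    have e1 : ‖((n : ℂ) + 1) ^ 2 * h6Coeff n
        + (17 * ((n : ℂ) + 1) ^ 2 + 17 * ((n : ℂ) + 1) + 6) * h6Coeff (n + 1)‖
        ≤ 72 * ((n : ℝ) + 2) ^ 2 := by
      have a1 : ‖((n : ℂ) + 1) ^ 2‖ = ((n : ℝ) + 1) ^ 2 := by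
        rw [show ((n : ℂ) + 1) ^ 2 = (((n + 1) ^ 2 : ℕ) : ℂ) by push_cast; ring,
          Complex.norm_natCast]
        push_cast
        ring
      have a2 : ‖17 * ((n : ℂ) + 1) ^ 2 + 17 * ((n : ℂ) + 1) + 6‖
          = 17 * ((n : ℝ) + 1) ^ 2 + 17 * ((n : ℝ) + 1) + 6 := by
        rw [show 17 * ((n : ℂ) + 1) ^ 2 + 17 * ((n : ℂ) + 1) + 6
            = ((17 * (n + 1) ^ 2 + 17 * (n + 1) + 6 : ℕ) : ℂ) by push_cast; ring,
          Complex.norm_natCast]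
        push_cast
        ring
      refine (norm_add_le _ _).trans ?_
      rw [norm_mul, norm_mul, a1, a2]
      have hn : (0 : ℝ) ≤ n := n.cast_nonneg
      have b1 := mul_le_mul_of_nonneg_left ih.1 (by positivity : (0 : ℝ) ≤ ((n : ℝ) + 1) ^ 2)
      have b2 := mul_le_mul_of_nonneg_left ih.2
        (by positivity : (0 : ℝ) ≤ 17 * ((n : ℝ) + 1) ^ 2 + 17 * ((n : ℝ) + 1) + 6)
      nlinarith
    have e2 : ‖72 * ((n : ℂ) + 2) ^ 2‖ = 72 * ((n : ℝ) + 2) ^ 2 := by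
      rw [show 72 * ((n : ℂ) + 2) ^ 2 = ((72 * (n + 2) ^ 2 : ℕ) : ℂ) by push_cast; ring,
        Complex.norm_natCast]
      push_cast
      ring
    rw [h6Coeff, norm_div, norm_neg, e2]
    exact div_le_one_of_le₀ e1 (by positivity)

/-! ### The differential equations of `h6` and of `₂F₁`, and uniqueness -/

/-- The self-adjoint form `(p f')' + (z + 6) f = 0`, `p = z (z + 8) (z + 9)`, of the differential
equation of `h6`, in a punctured neighbourhood of `0`. -/
def SolvesH6 (f : ℂ → ℂ) : Prop :=
  ∀ᶠ z in 𝓝[≠] (0 : ℂ), z * (z + 8) * (z + 9) * deriv (deriv f) z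
    + (3 * z ^ 2 + 34 * z + 72) * deriv f z + (z + 6) * f z = 0

theorem eventually_eq_zero_of_punctured {g : ℂ → ℂ} (hg : ContinuousAt g 0)
    (h : ∀ᶠ z in 𝓝[≠] (0 : ℂ), g z = 0) : ∀ᶠ z in 𝓝 (0 : ℂ), g z = 0 := by
  have h0 : g 0 = 0 := tendsto_nhds_unique (l := 𝓝[≠] (0 : ℂ))
    ((hg.tendsto.mono_left nhdsWithin_le_nhds).congr' h) tendsto_const_nhds
  filter_upwards [eventually_nhdsWithin_iff.1 h] with z hz
  rcases eq_or_ne z 0 with rfl | hz0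
  · exact h0
  · exact hz hz0

theorem SolvesH6.eventually_nhds {f : ℂ → ℂ} (hf : AnalyticAt ℂ f 0) (h : SolvesH6 f) :
    ∀ᶠ z in 𝓝 (0 : ℂ), z * (z + 8) * (z + 9) * deriv (deriv f) z
      + (3 * z ^ 2 + 34 * z + 72) * deriv f z + (z + 6) * f z = 0 := by
  refine eventually_eq_zero_of_punctured ?_ h
  have := hf.deriv.deriv.continuousAt
  have := hf.deriv.continuousAt
  have := hf.continuousAt
  fun_prop

theorem analyticAt_h6 : AnalyticAt ℂ h6 0 :=
  (hasSum_euler_derivatives norm_h6Coeff_le_one (fun _ => rfl) (by simp)).1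

theorem h6_zero : h6 0 = 1 := by
  have := (hasSum_euler_derivatives norm_h6Coeff_le_one (f := h6) (fun _ => rfl)
    (z := 0) (by simp)).2.1
  have h := hasSum_single (f := fun n : ℕ => h6Coeff n * 0 ^ n) 0 fun n hn => by simp [hn]
  simpa [h6Coeff] using this.unique h

theorem eventually_norm_lt_one : ∀ᶠ z in 𝓝 (0 : ℂ), ‖z‖ < 1 := by
  filter_upwards [Metric.ball_mem_nhds (0 : ℂ) one_pos] with z hz
  simpa using hz

theorem solvesH6_h6 : SolvesH6 h6 := by
  filter_upwards [self_mem_nhdsWithin, nhdsWithin_le_nhds eventually_norm_lt_one] with z h0 hz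
  -- The parameters come from `17 m² + 17 m + 6 = 17 m (m-1) + 34 m + 6` and `(n+1)² = n (n-1) + 3 n
  -- + 1`. The resulting equation carries an extra factor `z`, cancelled off `0`.
  have h := ode_of_recurrence norm_h6Coeff_le_one (f := h6) (fun _ => rfl) (κ := 72) (α₁ := 17)
    (β₁ := 34) (γ₁ := 6) (α₂ := 1) (β₂ := 3) (γ₂ := 1) (by norm_num [h6Coeff]) (fun n => by
      have := h6Coeff_recurrence (n + 1)
      simp only [Nat.add_sub_cancel, Nat.succ_ne_zero, if_false] at this
      push_cast at this
      linear_combination this) hz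
  refine (mul_eq_zero.1 ?_).resolve_left (h0 : z ≠ 0)
  linear_combination h

/-- The hypergeometric equation of `₂F₁(1/12, 5/12; 1; ·)`. -/
theorem hypergeometric_ode :
    AnalyticAt ℂ (ordinaryHypergeometric (1 / 12 : ℂ) (5 / 12 : ℂ) (1 : ℂ)) (0 : ℂ) ∧
    ∀ᶠ x in 𝓝 (0 : ℂ),
      x * (1 - x) * deriv (deriv (ordinaryHypergeometric (1 / 12 : ℂ) (5 / 12 : ℂ) (1 : ℂ))) x
      + (1 - 3 / 2 * x) * deriv (ordinaryHypergeometric (1 / 12 : ℂ) (5 / 12 : ℂ) (1 : ℂ)) x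
      - 5 / 144 * ordinaryHypergeometric (1 / 12 : ℂ) (5 / 12 : ℂ) (1 : ℂ) x = 0 := by
  set F : ℂ → ℂ := ordinaryHypergeometric (1 / 12 : ℂ) (5 / 12 : ℂ) (1 : ℂ) with hF
  set a : ℕ → ℂ := fun n => ordinaryHypergeometricCoefficient (1 / 12 : ℂ) (5 / 12) 1 n with ha
  have hfa : ∀ z, F z = ∑' n, a n * z ^ n := by
    intro z
    rw [hF, ordinaryHypergeometric_eq_tsum]
    rfl
  have hn1 : ∀ n : ℕ, (n : ℂ) + 1 ≠ 0 := fun n => by exact_mod_cast n.succ_ne_zero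
  have a0 : a 0 = 1 := by simp [ha, ordinaryHypergeometricCoefficient]
  have hrec : ∀ n : ℕ, a (n + 1) = (n + 1 / 12) * (n + 5 / 12) / ((n : ℂ) + 1) ^ 2 * a n := by
    intro n
    have := hn1 n
    simp only [ha, ordinaryHypergeometricCoefficient, ascPochhammer_succ_eval,
      Nat.factorial_succ, Nat.cast_mul, mul_inv]
    push_cast
    rw [add_comm (1 : ℂ) n, add_comm (1 / 12 : ℂ) n, add_comm (5 / 12 : ℂ) n]
    field_simp
  have hb : ∀ n, ‖a n‖ ≤ 1 := by
    intro n
    induction n with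
    | zero => simp [a0]
    | succ n ih =>
      have e : ((n : ℂ) + 1 / 12) * (n + 5 / 12) / ((n : ℂ) + 1) ^ 2
          = ((((n : ℝ) + 1 / 12) * (n + 5 / 12) / ((n : ℝ) + 1) ^ 2 : ℝ) : ℂ) := by push_cast; rfl
      have hn : (0 : ℝ) ≤ n := n.cast_nonneg
      rw [hrec, e, norm_mul, Complex.norm_real, Real.norm_of_nonneg (by positivity)]
      refine mul_le_one₀ (div_le_one_of_le₀ ?_ (by positivity)) (norm_nonneg _) ih
      nlinarith
  have hFan : AnalyticAt ℂ F 0 := (hasSum_euler_derivatives hb hfa (z := 0) (by simp)).1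
  refine ⟨hFan, eventually_eq_zero_of_punctured ?_ ?_⟩
  · have := hFan.deriv.deriv.continuousAt
    have := hFan.deriv.continuousAt
    have := hFan.continuousAt
    fun_prop
  filter_upwards [self_mem_nhdsWithin, nhdsWithin_le_nhds eventually_norm_lt_one] with x h0 hx
  -- Here `(n + 1/12) (n + 5/12) = n (n-1) + 3/2 n + 5/144`. The recurrence has two terms, so the
  -- last three parameters vanish.
  have h := ode_of_recurrence hb hfa (κ := 1) (α₁ := -1) (β₁ := -3 / 2) (γ₁ := -5 / 144) (α₂ := 0)
    (β₂ := 0) (γ₂ := 0) (by have := hrec 0; rw [zero_add] at this; rw [this]; push_cast; ring)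
    (fun n => by
      have h2 := hrec (n + 1)
      have h3 := hn1 (n + 1)
      push_cast at h2 h3
      rw [show (n : ℂ) + 2 = n + 1 + 1 by ring, h2]
      field_simp
      ring) hx
  refine (mul_eq_zero.1 ?_).resolve_left (h0 : x ≠ 0)
  linear_combination h

/-- Wronskian argument: an analytic solution is determined by its value at the singular point. -/
theorem SolvesH6.eventuallyEq {f g : ℂ → ℂ} (hf : AnalyticAt ℂ f 0) (hg : AnalyticAt ℂ g 0)
    (hf0 : f 0 = 1) (hg0 : g 0 = 1) (hfs : SolvesH6 f) (hgs : SolvesH6 g) : f =ᶠ[𝓝 0] g := by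
  have key : ∀ᶠ z in 𝓝 (0 : ℂ), AnalyticAt ℂ f z ∧ AnalyticAt ℂ g z ∧ g z ≠ 0 ∧ ‖z‖ < 1 ∧
      z * (z + 8) * (z + 9) * deriv (deriv f) z
        + (3 * z ^ 2 + 34 * z + 72) * deriv f z + (z + 6) * f z = 0 ∧
      z * (z + 8) * (z + 9) * deriv (deriv g) z
        + (3 * z ^ 2 + 34 * z + 72) * deriv g z + (z + 6) * g z = 0 := by
    filter_upwards [hf.eventually_analyticAt, hg.eventually_analyticAt,
      hg.continuousAt.eventually_ne (by rw [hg0]; exact one_ne_zero), eventually_norm_lt_one,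
      hfs.eventually_nhds hf, hgs.eventually_nhds hg]
      with z h1 h2 h3 h4 h5 h6 using ⟨h1, h2, h3, h4, h5, h6⟩
  obtain ⟨ε, hε, hball⟩ := Metric.eventually_nhds_iff_ball.1 key
  have hopen : IsOpen (Metric.ball (0 : ℂ) ε) := Metric.isOpen_ball
  have hconn : IsPreconnected (Metric.ball (0 : ℂ) ε) := (convex_ball 0 ε).isPreconnected
  have h0 : (0 : ℂ) ∈ Metric.ball (0 : ℂ) ε := Metric.mem_ball_self hε
  -- In self-adjoint form, `p` times the Wronskian has derivative zero. It is then constant, and the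
  -- constant is `0` because `p` vanishes at the origin.
  have hW : ∀ z ∈ Metric.ball (0 : ℂ) ε, HasDerivAt
      (fun z => z * (z + 8) * (z + 9) * (deriv f z * g z - f z * deriv g z)) 0 z := by
    intro z hz
    obtain ⟨af, ag, -, -, hf2, hg2⟩ := hball z hz
    have d := (((hasDerivAt_id z).mul ((hasDerivAt_id z).add_const 8)).mul
      ((hasDerivAt_id z).add_const 9)).mul
      ((af.deriv.differentiableAt.hasDerivAt.mul ag.differentiableAt.hasDerivAt).sub
        (af.differentiableAt.hasDerivAt.mul ag.deriv.differentiableAt.hasDerivAt))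
    refine d.congr_deriv ?_
    simp only [id_eq, Pi.mul_apply, Pi.sub_apply]
    linear_combination g z * hf2 - f z * hg2
  have hWr : ∀ z ∈ Metric.ball (0 : ℂ) ε, z ≠ 0 → deriv f z * g z - f z * deriv g z = 0 := by
    intro z hz hz0
    have hc := hopen.is_const_of_deriv_eq_zero hconn
      (fun w hw => (hW w hw).differentiableAt.differentiableWithinAt)
      (fun w hw => (hW w hw).deriv) hz h0
    have hz1 := (hball z hz).2.2.2.1
    have h8 : z + 8 ≠ 0 := fun h => by
      rw [eq_neg_of_add_eq_zero_left h] at hz1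
      norm_num at hz1
    have h9 : z + 9 ≠ 0 := fun h => by
      rw [eq_neg_of_add_eq_zero_left h] at hz1
      norm_num at hz1
    simpa [hz0, h8, h9] using hc
  have hQ : ∀ z ∈ Metric.ball (0 : ℂ) ε, deriv (fun z => f z / g z) z = 0 := by
    have hq : ∀ z ∈ Metric.ball (0 : ℂ) ε, AnalyticAt ℂ (fun z => f z / g z) z := fun z hz =>
      (hball z hz).1.div (hball z hz).2.1 (hball z hz).2.2.1
    have hne : ∀ z ∈ Metric.ball (0 : ℂ) ε, z ≠ 0 → deriv (fun z => f z / g z) z = 0 := by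
      intro z hz hz0
      obtain ⟨af, ag, hgz, -⟩ := hball z hz
      have := (af.differentiableAt.hasDerivAt.div ag.differentiableAt.hasDerivAt hgz).deriv
      refine (this.trans ?_)
      rw [hWr z hz hz0, zero_div]
    intro z hz
    rcases eq_or_ne z 0 with rfl | hz0
    -- The Wronskian is known to vanish only off `0`; continuity of the derivative of `f / g` covers
    -- the origin.
    · refine tendsto_nhds_unique (l := 𝓝[≠] (0 : ℂ))
        ((hq 0 hz).deriv.continuousAt.tendsto.mono_left nhdsWithin_le_nhds)
        ((tendsto_const_nhds (x := (0 : ℂ))).congr' ?_)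
      filter_upwards [self_mem_nhdsWithin, nhdsWithin_le_nhds (hopen.mem_nhds hz)] with w h1 h2
        using (hne w h2 h1).symm
    · exact hne z hz hz0
  filter_upwards [hopen.mem_nhds h0] with z hz
  have := hopen.is_const_of_deriv_eq_zero hconn (f := fun z => f z / g z)
    (fun w hw => ((hball w hw).1.div (hball w hw).2.1
      (hball w hw).2.2.1).differentiableAt.differentiableWithinAt) hQ hz h0
  simp only [hf0, hg0, div_one] at this
  exact (div_eq_one_iff_eq (hball z hz).2.2.1).1 this

/-! ### Pullbacks of the hypergeometric equation -/

open Polynomial in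
/-- If the rational function `x = p n / G ^ 3`, `p = z (z + 8) (z + 9)`, pulls the hypergeometric
equation back to that of `h6`, up to the factor `G ^ (-1/4)`, then it expresses `h6` through
`₂F₁`. -/
theorem h6_eventuallyEq_pullback (G R n : ℂ[X]) (c : ℂ) (hG0 : G.eval 0 ≠ 0)
    (hR : ∀ z, G.eval z ^ 3 - z * (z + 8) * (z + 9) * n.eval z = R.eval z ^ 2)
    (hx : ∀ z, ((3 * z ^ 2 + 34 * z + 72) * n.eval z
        + z * (z + 8) * (z + 9) * (derivative n).eval z) * G.eval z
      - 3 * (z * (z + 8) * (z + 9) * n.eval z) * (derivative G).eval z = c * R.eval z * n.eval z)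
    (h1 : ∀ z, ((derivative R).eval z * (z * (z + 8) * (z + 9)) * n.eval z
        + R.eval z * ((3 * z ^ 2 + 34 * z + 72) * n.eval z
        + z * (z + 8) * (z + 9) * (derivative n).eval z)) * G.eval z
      - 9 / 2 * R.eval z * (z * (z + 8) * (z + 9)) * n.eval z * (derivative G).eval z
      = c * n.eval z * (G.eval z ^ 3 - 3 / 2 * (z * (z + 8) * (z + 9) * n.eval z)))
    (h2 : ∀ z, -4 * G.eval z * ((3 * z ^ 2 + 34 * z + 72) * (derivative G).eval z
        + z * (z + 8) * (z + 9) * (derivative (derivative G)).eval z)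
      + 5 * (z * (z + 8) * (z + 9)) * (derivative G).eval z ^ 2 + 16 * (z + 6) * G.eval z ^ 2
      = -(5 / 9) * c ^ 2 * n.eval z) :
    ∀ᶠ z in 𝓝 (0 : ℂ), h6 z = (G.eval z ^ 3 / G.eval 0 ^ 3) ^ (-(1 / 12) : ℂ)
      * ordinaryHypergeometric (1 / 12 : ℂ) (5 / 12 : ℂ) (1 : ℂ)
        (z * (z + 8) * (z + 9) * n.eval z / G.eval z ^ 3) := by
  obtain ⟨hFan, hode⟩ := hypergeometric_ode
  set F : ℂ → ℂ := ordinaryHypergeometric (1 / 12 : ℂ) (5 / 12 : ℂ) (1 : ℂ) with hF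
  set B : ℂ → ℂ := fun z => (G.eval z ^ 3 / G.eval 0 ^ 3) ^ (-(1 / 12) : ℂ) with hB
  set x : ℂ → ℂ := fun z => z * (z + 8) * (z + 9) * n.eval z / G.eval z ^ 3 with hxdef
  have evan (p : ℂ[X]) (z : ℂ) : AnalyticAt ℂ (fun w => p.eval w) z := by
    simpa using AnalyticAt.aeval_polynomial (analyticAt_id (𝕜 := ℂ) (z := z)) p
  have hx0 : x 0 = 0 := by simp [hxdef]
  have hs0 : G.eval 0 ^ 3 / G.eval 0 ^ 3 = 1 := div_self (pow_ne_zero 3 hG0)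
  have hxan : AnalyticAt ℂ x 0 :=
    ((((analyticAt_id.mul (analyticAt_id.add analyticAt_const)).mul
      (analyticAt_id.add analyticAt_const)).mul (evan n 0))).div ((evan G 0).pow 3)
      (pow_ne_zero 3 hG0)
  have hban : AnalyticAt ℂ (fun z => G.eval z ^ 3 / G.eval 0 ^ 3) 0 :=
    ((evan G 0).pow 3).div_const
  have hBan : AnalyticAt ℂ B 0 :=
    hban.cpow analyticAt_const (by simp only [hs0]; exact Complex.one_mem_slitPlane)
  have hFx : AnalyticAt ℂ F (x 0) := by rw [hx0]; exact hFan
  have hfan : AnalyticAt ℂ (fun z => B z * F (x z)) 0 := hBan.mul (hFx.comp hxan)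
  have hf0 : B 0 * F (x 0) = 1 := by
    rw [hx0, hF, ordinaryHypergeometric_zero, hB]
    simp only [hs0, Complex.one_cpow, mul_one]
  refine SolvesH6.eventuallyEq analyticAt_h6 hfan h6_zero hf0 solvesH6_h6 ?_
  change SolvesH6 (fun z => B z * F (x z))
  have hxt : Tendsto x (𝓝 0) (𝓝 0) := by simpa [hx0] using hxan.continuousAt.tendsto
  have hGne : ∀ᶠ z in 𝓝 (0 : ℂ), G.eval z ≠ 0 :=
    (evan G 0).continuousAt.eventually_ne hG0
  have hslit : ∀ᶠ z in 𝓝 (0 : ℂ), G.eval z ^ 3 / G.eval 0 ^ 3 ∈ Complex.slitPlane :=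
    hban.continuousAt.eventually_mem (Complex.isOpen_slitPlane.mem_nhds
      (by simp only [hs0]; exact Complex.one_mem_slitPlane))
  have hBd : ∀ᶠ z in 𝓝 (0 : ℂ),
      HasDerivAt B (-((derivative G).eval z / (4 * G.eval z)) * B z) z := by
    filter_upwards [hGne, hslit] with z hz hsz
    refine ((((G.hasDerivAt z).pow 3).div_const _).cpow_const hsz).congr_deriv ?_
    have hne := Complex.slitPlane_ne_zero hsz
    simp only [Pi.pow_apply, hB]
    rw [Complex.cpow_sub _ _ hne, Complex.cpow_one]
    field_simp
    norm_num
    ring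
  have hxd : ∀ᶠ z in 𝓝 (0 : ℂ),
      HasDerivAt x (c * R.eval z * n.eval z / G.eval z ^ 4) z := by
    filter_upwards [hGne] with z hz
    refine ((((((hasDerivAt_id z).mul ((hasDerivAt_id z).add_const 8)).mul
      ((hasDerivAt_id z).add_const 9)).mul (n.hasDerivAt z)).div ((G.hasDerivAt z).pow 3)
      (pow_ne_zero 3 hz))).congr_deriv ?_
    have := hx z
    simp only [Pi.mul_apply, Pi.pow_apply, id_eq]
    field_simp
    push_cast
    linear_combination G.eval z ^ 2 * this
  have hFd : ∀ᶠ z in 𝓝 (0 : ℂ), AnalyticAt ℂ F (x z) := hxt.eventually hFan.eventually_analyticAt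
  have hfd : ∀ᶠ z in 𝓝 (0 : ℂ), HasDerivAt (fun z => B z * F (x z))
      (B z * (-((derivative G).eval z / (4 * G.eval z)) * F (x z)
        + c * R.eval z * n.eval z / G.eval z ^ 4 * deriv F (x z))) z := by
    filter_upwards [hBd, hxd, hFd] with z hBz hxz hFz
    refine (hBz.mul (hFz.differentiableAt.hasDerivAt.comp z hxz)).congr_deriv ?_
    simp only [Function.comp_apply]
    ring
  refine Eventually.filter_mono nhdsWithin_le_nhds ?_
  filter_upwards [hGne, hBd, hxd, hFd, hfd, hfd.eventually_nhds, hxt.eventually hode]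
    with z hG hBz hxz hFz hfz hfz' hodez
  have hde : deriv (fun z => B z * F (x z)) =ᶠ[𝓝 z] fun z =>
      B z * (-((derivative G).eval z / (4 * G.eval z)) * F (x z)
        + c * R.eval z * n.eval z / G.eval z ^ 4 * deriv F (x z)) :=
    hfz'.mono fun w hw => hw.deriv
  have hFc := hFz.differentiableAt.hasDerivAt.comp z hxz
  have hFc' := hFz.deriv.differentiableAt.hasDerivAt.comp z hxz
  have h4G : 4 * G.eval z ≠ 0 := mul_ne_zero (by norm_num) hG
  have hb := (((derivative G).hasDerivAt z).div ((G.hasDerivAt z).const_mul (4 : ℂ))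
    h4G).neg
  have hy := ((((R.hasDerivAt z).const_mul c).mul (n.hasDerivAt z)).div ((G.hasDerivAt z).pow 4)
    (pow_ne_zero 4 hG))
  have hdd := (hBz.mul ((hb.mul hFc).add (hy.mul hFc'))).deriv
  have hd2 : deriv (deriv (fun z => B z * F (x z))) z = _ := hde.deriv_eq.trans hdd
  rw [hd2, hfz.deriv]
  simp only [Pi.mul_apply, Pi.pow_apply, Pi.add_apply, Pi.neg_apply, Pi.div_apply,
    Function.comp_apply]
  -- The operator of `h6` applied to `B * F(x)` should be `B * c² n / G²` times the hypergeometric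
  -- operator at `x`. The identities `e2`, `e1'` and `e0'` match the coefficients of `F''`, `F'` and
  -- `F`; `e2` rests on `1 - x = R² / G³`.
  have e2 : z * (z + 8) * (z + 9) * (c * R.eval z * n.eval z / G.eval z ^ 4) ^ 2
      = c ^ 2 * n.eval z / G.eval z ^ 2 * (x z * (1 - x z)) := by
    simp only [hxdef]
    field_simp
    linear_combination
      -(c ^ 2 * n.eval z ^ 2 * (z * (z + 8) * (z + 9))) * hR z
  have e1 := h1 z
  have e0 := h2 z
  have e3 : x z * G.eval z ^ 3 = z * (z + 8) * (z + 9) * n.eval z :=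
    div_mul_cancel₀ _ (pow_ne_zero 3 hG)
  generalize x z = X at *
  generalize F X = F0 at *
  generalize deriv F X = F1 at *
  generalize deriv (deriv F) X = F2 at *
  generalize B z = b at *
  generalize (derivative (derivative G)).eval z = G2 at *
  generalize (derivative G).eval z = G1 at *
  generalize G.eval z = g at *
  generalize (derivative R).eval z = R1 at *
  generalize R.eval z = r at *
  generalize (derivative n).eval z = n1 at *
  generalize n.eval z = m at *
  have e1' : z * (z + 8) * (z + 9) * (2 * -(G1 / (4 * g)) * (c * r * m / g ^ 4)
        + ((c * R1 * m + c * r * n1) * g ^ 4 - c * r * m * (4 * g ^ 3 * G1)) / (g ^ 4) ^ 2)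
      + (3 * z ^ 2 + 34 * z + 72) * (c * r * m / g ^ 4) = c ^ 2 * m / g ^ 2 * (1 - 3 / 2 * X) := by
    rw [eq_div_of_mul_eq (pow_ne_zero 3 hG) e3]
    field_simp
    linear_combination 8 * c * e1
  have e0' : z * (z + 8) * (z + 9)
        * (-((G2 * (4 * g) - G1 * (4 * G1)) / (4 * g) ^ 2) + (G1 / (4 * g)) ^ 2)
      + (3 * z ^ 2 + 34 * z + 72) * -(G1 / (4 * g)) + (z + 6)
      = -(5 / 144) * (c ^ 2 * m / g ^ 2) := by
    field_simp
    linear_combination 144 * e0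
  push_cast
  linear_combination b * (F2 * e2 + F1 * e1' + F0 * e0') + b * (c ^ 2 * m / g ^ 2) * hodez

/-- The given representation of `h6` by `₂F₁`. -/
theorem h6_eq_hypergeometric : ∀ᶠ z in 𝓝 (0 : ℂ), h6 z =
    (((z + 6) * (z ^ 3 + 18 * z ^ 2 + 84 * z + 24)) ^ 3 / 144 ^ 3) ^ (-(1 / 12) : ℂ)
      * ordinaryHypergeometric (1 / 12 : ℂ) (5 / 12 : ℂ) (1 : ℂ)
        (1728 * z * (z + 9) ^ 2 * (z + 8) ^ 3
          / ((z + 6) * (z ^ 3 + 18 * z ^ 2 + 84 * z + 24)) ^ 3) := by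
  -- The second polynomial is a square root of `G³ - p n`. Lowest-order terms in the formula for
  -- `x'` give `c = 72 m G(0) / R(0)`, with `m` the order of `x` at `0`; here `m = 1`, so `c = 72 *
  -- 144 / (-1728) = -6`.
  have h := h6_eventuallyEq_pullback
    ((Polynomial.X + 6) * (Polynomial.X ^ 3 + 18 * Polynomial.X ^ 2 + 84 * Polynomial.X + 24))
    (Polynomial.X ^ 6 + 36 * Polynomial.X ^ 5 + 504 * Polynomial.X ^ 4 + 3384 * Polynomial.X ^ 3
      + 10584 * Polynomial.X ^ 2 + 11232 * Polynomial.X - 1728)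
    (1728 * (Polynomial.X + 9) * (Polynomial.X + 8) ^ 2) (-6)
    (by simp) (fun z => by simp; ring)
    (fun z => by simp [Polynomial.derivative_pow]; ring)
    (fun z => by simp [Polynomial.derivative_pow]; ring)
    (fun z => by simp [Polynomial.derivative_pow]; ring)
  filter_upwards [h] with z hz
  rw [hz]
  simp only [Polynomial.eval_add, Polynomial.eval_mul, Polynomial.eval_pow, Polynomial.eval_X,
    Polynomial.eval_ofNat]
  congr 2
  · norm_num
  · congr 1
    ring

/-- The representation of `h6` by `₂F₁` obtained from the given one by the Fricke involution
`z ↦ 72 / z`. -/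
theorem h6_eq_hypergeometric_fricke : ∀ᶠ z in 𝓝 (0 : ℂ), h6 z =
    (((z + 12) * (z ^ 3 + 252 * z ^ 2 + 3888 * z + 15552)) ^ 3 / 186624 ^ 3) ^ (-(1 / 12) : ℂ)
      * ordinaryHypergeometric (1 / 12 : ℂ) (5 / 12 : ℂ) (1 : ℂ)
        (1728 * z ^ 6 * (z + 9) ^ 3 * (z + 8) ^ 2
          / ((z + 12) * (z ^ 3 + 252 * z ^ 2 + 3888 * z + 15552)) ^ 3) := by
  -- Now `x` vanishes to order `6` at `0`, and the same formula gives `c = 6 * 72 * 186624 /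
  -- (-80621568) = -1`.
  have h := h6_eventuallyEq_pullback
    ((Polynomial.X + 12)
      * (Polynomial.X ^ 3 + 252 * Polynomial.X ^ 2 + 3888 * Polynomial.X + 15552))
    (Polynomial.X ^ 6 - 468 * Polynomial.X ^ 5 - 31752 * Polynomial.X ^ 4
      - 730944 * Polynomial.X ^ 3 - 7838208 * Polynomial.X ^ 2 - 40310784 * Polynomial.X - 80621568)
    (1728 * Polynomial.X ^ 5 * (Polynomial.X + 9) ^ 2 * (Polynomial.X + 8)) (-1)
    (by simp) (fun z => by simp; ring)
    (fun z => by simp [Polynomial.derivative_pow]; ring)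
    (fun z => by simp [Polynomial.derivative_pow]; ring)
    (fun z => by simp [Polynomial.derivative_pow]; ring)
  filter_upwards [h] with z hz
  rw [hz]
  simp only [Polynomial.eval_add, Polynomial.eval_mul, Polynomial.eval_pow, Polynomial.eval_X,
    Polynomial.eval_ofNat]
  congr 2
  · norm_num
  · congr 1
    ring

/-! ### Modular equations -/

/-- The symmetric modular equation satisfied by the sum and the product. -/
theorem symmetric_modular_equation {t S P : ℂ}
    (hS : S = (t - 2) * (t ^ 5 - 10 * t ^ 4 + 28 * t ^ 3 - 26 * t ^ 2 + 20 * t + 4))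
    (hP : P = 72 * t * (t - 2) ^ 2 * (t ^ 2 - t + 1)) :
    139314069504 * S ^ 5 + 58047528960 * S ^ 4 * P + 3622165807104 * S ^ 4
      + 9110237184 * S ^ 3 * P ^ 2 + 673351335936 * S ^ 3 * P + 31345665638400 * S ^ 3
      + 655423488 * S ^ 2 * P ^ 3 - 33780436992 * S ^ 2 * P ^ 2 - 5050135019520 * S ^ 2 * P
      + 90275517038592 * S ^ 2 + 20513088 * S * P ^ 4 - 12429158400 * S * P ^ 3
      - 2226122735616 * S * P ^ 2 - 87767863787520 * S * P - P ^ 6 + 196560 * P ^ 5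
      - 592904448 * P ^ 4 - 141329608704 * P ^ 3 - 10796840386560 * P ^ 2
      - 270826551115776 * P = 0 := by
  rw [hS, hP]
  ring

theorem fricke_invariant_eq {t z w : ℂ}
    (hS : z + w = (t - 2) * (t ^ 5 - 10 * t ^ 4 + 28 * t ^ 3 - 26 * t ^ 2 + 20 * t + 4))
    (hP : z * w = 72 * t * (t - 2) ^ 2 * (t ^ 2 - t + 1)) :
    z ^ 6 * (z + 9) ^ 3 * (z + 8) ^ 2
        * ((w + 12) * (w ^ 3 + 252 * w ^ 2 + 3888 * w + 15552)) ^ 3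
      = w ^ 6 * (w + 9) ^ 3 * (w + 8) ^ 2
        * ((z + 12) * (z ^ 3 + 252 * z ^ 2 + 3888 * z + 15552)) ^ 3 := by
  have h := symmetric_modular_equation hS hP
  -- The difference is antisymmetric in `z` and `w`, hence `z - w` times a polynomial in the sum and
  -- product. That polynomial factors, and its last factor is the symmetric modular equation.
  have e (S P : ℂ) (hS : S = z + w) (hP : P = z * w) :
      z ^ 6 * (z + 9) ^ 3 * (z + 8) ^ 2
        * ((w + 12) * (w ^ 3 + 252 * w ^ 2 + 3888 * w + 15552)) ^ 3
      - w ^ 6 * (w + 9) ^ 3 * (w + 8) ^ 2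
        * ((z + 12) * (z ^ 3 + 252 * z ^ 2 + 3888 * z + 15552)) ^ 3
      = (z - w) * (46656 * S ^ 5 + 27216 * S ^ 4 * P + 793152 * S ^ 4 + 6345 * S ^ 3 * P ^ 2
          + 322704 * S ^ 3 * P + 3359232 * S ^ 3 + 739 * S ^ 2 * P ^ 3 + 46872 * S ^ 2 * P ^ 2
          + 373248 * S ^ 2 * P + 43 * S * P ^ 4 + 2790 * S * P ^ 3 - 69984 * S * P ^ 2
          - 3359232 * S * P + P ^ 5 + 53 * P ^ 4 - 7992 * P ^ 3 - 466560 * P ^ 2)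
        * (139314069504 * S ^ 5 + 58047528960 * S ^ 4 * P + 3622165807104 * S ^ 4
          + 9110237184 * S ^ 3 * P ^ 2 + 673351335936 * S ^ 3 * P + 31345665638400 * S ^ 3
          + 655423488 * S ^ 2 * P ^ 3 - 33780436992 * S ^ 2 * P ^ 2 - 5050135019520 * S ^ 2 * P
          + 90275517038592 * S ^ 2 + 20513088 * S * P ^ 4 - 12429158400 * S * P ^ 3
          - 2226122735616 * S * P ^ 2 - 87767863787520 * S * P - P ^ 6 + 196560 * P ^ 5
          - 592904448 * P ^ 4 - 141329608704 * P ^ 3 - 10796840386560 * P ^ 2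
          - 270826551115776 * P) := by
    rw [hS, hP]
    ring
  rw [← sub_eq_zero, e _ _ rfl rfl, h, mul_zero]

/-- Substituting `w = 72 / v` carries the Fricke argument of `₂F₁` at `w` to the given one at `v`.
The conclusion is the equality of the two arguments, cross-multiplied and without the factor `1728`.
-/
theorem modular_invariant_eq {t z v : ℂ} (hv : v ≠ 0)
    (hS : z + 72 / v = (t - 2) * (t ^ 5 - 10 * t ^ 4 + 28 * t ^ 3 - 26 * t ^ 2 + 20 * t + 4))
    (hP : z * (72 / v) = 72 * t * (t - 2) ^ 2 * (t ^ 2 - t + 1)) :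
    z ^ 6 * (z + 9) ^ 3 * (z + 8) ^ 2 * ((v + 6) * (v ^ 3 + 18 * v ^ 2 + 84 * v + 24)) ^ 3
      = v * (v + 9) ^ 2 * (v + 8) ^ 3
        * ((z + 12) * (z ^ 3 + 252 * z ^ 2 + 3888 * z + 15552)) ^ 3 := by
  have h := fricke_invariant_eq hS hP
  have e1 : (72 / v + 12) * ((72 / v) ^ 3 + 252 * (72 / v) ^ 2 + 3888 * (72 / v) + 15552)
      = 186624 * ((v + 6) * (v ^ 3 + 18 * v ^ 2 + 84 * v + 24)) / v ^ 4 := by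
    field_simp
    ring
  have e2 : (72 / v) ^ 6 * (72 / v + 9) ^ 3 * (72 / v + 8) ^ 2
      = 186624 ^ 3 * (v * (v + 9) ^ 2 * (v + 8) ^ 3) / v ^ 12 := by
    rw [show 72 / v + 9 = 9 * (v + 8) / v by field_simp; ring,
      show 72 / v + 8 = 8 * (v + 9) / v by field_simp; ring]
    field_simp
    ring
  rw [e1, e2, div_pow, ← pow_mul, mul_div_assoc', div_mul_eq_mul_div,
    div_left_inj' (pow_ne_zero _ hv)] at h
  refine mul_left_cancel₀ (pow_ne_zero 3 (by norm_num : (186624 : ℂ) ≠ 0)) ?_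
  linear_combination h

/-! ### Principal powers -/

/-- Both arguments lie strictly between `-π/2` and `π/2`, so their sum stays within the principal
range. -/
theorem mul_cpow_of_re_pos {x y : ℂ} (hx : 0 < x.re) (hy : 0 < y.re) (a : ℂ) :
    (x * y) ^ a = x ^ a * y ^ a := by
  have hx0 : x ≠ 0 := by rintro rfl; simp at hx
  have hy0 : y ≠ 0 := by rintro rfl; simp at hy
  have h1 := abs_lt.1 (Complex.abs_arg_lt_pi_div_two_iff.2 (Or.inl hx))
  have h2 := abs_lt.1 (Complex.abs_arg_lt_pi_div_two_iff.2 (Or.inl hy))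
  rw [Complex.cpow_def_of_ne_zero (mul_ne_zero hx0 hy0), Complex.cpow_def_of_ne_zero hx0,
    Complex.cpow_def_of_ne_zero hy0, ← Complex.exp_add, ← add_mul,
    Complex.log_mul hx0 hy0 ⟨by linarith, by linarith⟩]

theorem six_mul_cpow {q : ℂ} (hq : q ≠ 0) :
    6 * (6 ^ 12 * q) ^ (-(1 / 12) : ℂ) = q ^ (-(1 / 12) : ℂ) := by
  have h6 : ((6 : ℂ) ^ 12 * q) = ((6 ^ 12 : ℝ) : ℂ) * q := by push_cast; rfl
  rw [h6, Complex.cpow_def_of_ne_zero (mul_ne_zero (by norm_num) hq),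
    Complex.log_ofReal_mul (by norm_num) hq, Complex.cpow_def_of_ne_zero hq, add_mul,
    Complex.exp_add, Real.log_pow, ← mul_assoc]
  have : Complex.exp (((12 : ℕ) * Real.log 6 : ℝ) * (-(1 / 12))) = 6⁻¹ := by
    rw [show (((12 : ℕ) * Real.log 6 : ℝ) : ℂ) * (-(1 / 12)) = ((-Real.log 6 : ℝ) : ℂ) by
      push_cast; ring, ← Complex.ofReal_exp, Real.exp_neg, Real.exp_log (by norm_num)]
    push_cast
    rfl
  rw [this]
  norm_num

/-! ### The local Heun function -/

/-- Heun's equation for `Hl` at `x` is the equation of `h6` for `z ↦ Hl (-z / 8)` at `-8 x`. -/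
theorem heun_equation_iff (Hl : ℂ → ℂ) {x : ℂ} (h0 : x ≠ 0) (h1 : x - 1 ≠ 0)
    (h2 : x - 9 / 8 ≠ 0) {z : ℂ} (hz : z = -8 * x) :
    deriv (deriv Hl) x
        + ((1 : ℂ) / x + 1 / (x - 1) + (1 + 1 - 1 - 1 + 1) / (x - 9 / 8)) * deriv Hl x
        + (1 * 1 * x - 3 / 4) / (x * (x - 1) * (x - 9 / 8)) * Hl x = 0 ↔
      z * (z + 8) * (z + 9) * deriv (deriv fun z => Hl (-z / 8)) z
        + (3 * z ^ 2 + 34 * z + 72) * deriv (fun z => Hl (-z / 8)) z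
        + (z + 6) * Hl (-z / 8) = 0 := by
  have e : (fun z => Hl (-z / 8)) = fun z => Hl ((-1 / 8 : ℂ) * z) := by
    funext w
    congr 1
    ring
  have d1 : deriv (fun z => Hl ((-1 / 8 : ℂ) * z))
      = fun z => (-1 / 8 : ℂ) * deriv Hl ((-1 / 8 : ℂ) * z) := by
    funext w
    exact deriv_comp_mul_left _ _ _
  have d2 : deriv (fun z => (-1 / 8 : ℂ) * deriv Hl ((-1 / 8 : ℂ) * z)) z
      = (-1 / 8 : ℂ) * ((-1 / 8 : ℂ) * deriv (deriv Hl) ((-1 / 8 : ℂ) * z)) := by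
    rw [deriv_const_mul_field, deriv_comp_mul_left, smul_eq_mul]
  have e3 : -z / 8 = x := by rw [hz]; ring
  have e4 : (-1 / 8 : ℂ) * z = x := by rw [hz]; ring
  rw [e, d1, d2, e3]
  simp only [e4]
  rw [hz]
  -- Under `z = -8 x` the two operators differ by the factor `-8 x (x - 1) (x - 9/8)`, nonzero by
  -- hypothesis.
  have key : -8 * x * (-8 * x + 8) * (-8 * x + 9) * (-1 / 8 * (-1 / 8 * deriv (deriv Hl) x))
        + (3 * (-8 * x) ^ 2 + 34 * (-8 * x) + 72) * (-1 / 8 * deriv Hl x)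
        + (-8 * x + 6) * Hl x
      = -8 * (x * (x - 1) * (x - 9 / 8)) * (deriv (deriv Hl) x
        + ((1 : ℂ) / x + 1 / (x - 1) + (1 + 1 - 1 - 1 + 1) / (x - 9 / 8)) * deriv Hl x
        + (1 * 1 * x - 3 / 4) / (x * (x - 1) * (x - 9 / 8)) * Hl x) := by
    generalize deriv (deriv Hl) x = H2
    generalize deriv Hl x = H1
    have e5 : x * (x - 1) * (x - 9 / 8)
          * ((1 : ℂ) / x + 1 / (x - 1) + (1 + 1 - 1 - 1 + 1) / (x - 9 / 8))
        = (x - 1) * (x - 9 / 8) + x * (x - 9 / 8) + x * (x - 1) := by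
      generalize hu : x - 1 = u at *
      generalize hw : x - 9 / 8 = w at *
      field_simp
      ring
    have e6 : x * (x - 1) * (x - 9 / 8)
        * ((1 * 1 * x - 3 / 4) / (x * (x - 1) * (x - 9 / 8))) = x - 3 / 4 := by
      rw [mul_div_cancel₀ _ (mul_ne_zero (mul_ne_zero h0 h1) h2)]
      ring
    linear_combination 8 * H1 * e5 + 8 * Hl x * e6
  rw [key]
  simp [h0, h1, h2]

theorem eventually_heun_nonsingular :
    ∀ᶠ x in 𝓝[≠] (0 : ℂ), x ≠ 0 ∧ x - 1 ≠ 0 ∧ x - 9 / 8 ≠ 0 := by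
  have h1 : ∀ᶠ x in 𝓝 (0 : ℂ), x - 1 ≠ 0 :=
    ContinuousAt.eventually_ne (by fun_prop) (by norm_num)
  have h2 : ∀ᶠ x in 𝓝 (0 : ℂ), x - 9 / 8 ≠ 0 :=
    ContinuousAt.eventually_ne (by fun_prop) (by norm_num)
  filter_upwards [self_mem_nhdsWithin, nhdsWithin_le_nhds h1, nhdsWithin_le_nhds h2]
    with x a b c using ⟨a, b, c⟩

theorem tendsto_const_mul_nhdsNE_zero {c : ℂ} (hc : c ≠ 0) :
    Tendsto (fun x => c * x) (𝓝[≠] 0) (𝓝[≠] 0) := by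
  refine tendsto_nhdsWithin_iff.2 ⟨?_, ?_⟩
  · have : Tendsto (fun x => c * x) (𝓝 0) (𝓝 (c * 0)) :=
      (continuous_const_mul c).tendsto 0
    rw [mul_zero] at this
    exact this.mono_left nhdsWithin_le_nhds
  · filter_upwards [self_mem_nhdsWithin] with x hx using mul_ne_zero hc hx

/-- The condition of being the local Heun function, in terms of the equation of `h6`. -/
theorem isLocalHeun_iff_solvesH6 (Hl : ℂ → ℂ) :
    IsLocalHeun (9 / 8) (3 / 4) 1 1 1 1 Hl ↔
      AnalyticAt ℂ Hl 0 ∧ Hl 0 = 1 ∧ SolvesH6 fun z => Hl (-z / 8) := by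
  refine and_congr_right fun _ => and_congr_right fun _ => ⟨fun h => ?_, fun h => ?_⟩
  · filter_upwards [(tendsto_const_mul_nhdsNE_zero (by norm_num : (-1 / 8 : ℂ) ≠ 0)).eventually
      (h.and eventually_heun_nonsingular)] with z ⟨hz, h0, h1, h2⟩
    exact (heun_equation_iff Hl h0 h1 h2 (by ring)).1 hz
  · filter_upwards [(tendsto_const_mul_nhdsNE_zero (by norm_num : (-8 : ℂ) ≠ 0)).eventually h,
      eventually_heun_nonsingular] with x hx ⟨h0, h1, h2⟩
    exact (heun_equation_iff Hl h0 h1 h2 rfl).2 hx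

theorem SolvesH6.congr {f g : ℂ → ℂ} (hf : SolvesH6 f) (h : f =ᶠ[𝓝 0] g) : SolvesH6 g := by
  filter_upwards [hf, nhdsWithin_le_nhds (eventually_eventually_nhds.2 h)] with z hz hfg
  have hfg' : f =ᶠ[𝓝 z] g := hfg
  rw [← hfg'.deriv.deriv_eq, ← hfg'.deriv_eq, ← hfg'.eq_of_nhds]
  exact hz

/-- Forward, this is uniqueness of the normalized analytic solution. Backward, analyticity, the
value at `0` and the equation all depend only on the germ, and `h6` has them. -/
theorem isLocalHeun_iff (Hl : ℂ → ℂ) :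
    IsLocalHeun (9 / 8) (3 / 4) 1 1 1 1 Hl ↔ ∀ᶠ z in 𝓝 (0 : ℂ), h6 z = Hl (-z / 8) := by
  rw [isLocalHeun_iff_solvesH6]
  constructor
  · rintro ⟨ha, h0, hs⟩
    have hc : AnalyticAt ℂ (fun z => Hl (-z / 8)) 0 :=
      AnalyticAt.fun_comp (by simpa using ha) (by fun_prop)
    exact solvesH6_h6.eventuallyEq analyticAt_h6 hc h6_zero (by simpa using h0) hs
  · intro h
    have ht : Tendsto (fun x : ℂ => -8 * x) (𝓝 0) (𝓝 0) := by
      have : Tendsto (fun x : ℂ => -8 * x) (𝓝 0) (𝓝 (-8 * 0)) :=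
        (continuous_const_mul (-8)).tendsto 0
      simpa using this
    have he : (fun x => h6 (-8 * x)) =ᶠ[𝓝 0] Hl := by
      filter_upwards [ht.eventually h] with x hx
      rw [hx]
      congr 1
      ring
    refine ⟨AnalyticAt.congr (AnalyticAt.fun_comp (by simpa using analyticAt_h6) (by fun_prop)) he,
      ?_, solvesH6_h6.congr h⟩
    rw [← he.eq_of_nhds]
    simpa using h6_zero

/-! ### The branch at infinity -/

/-- The sum `z + 72 / z'` as a function of `t`. -/
noncomputable def branchSum (t : ℂ) : ℂ :=
  (t - 2) * (t ^ 5 - 10 * t ^ 4 + 28 * t ^ 3 - 26 * t ^ 2 + 20 * t + 4)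

/-- The product `z * (72 / z')` as a function of `t`. -/
noncomputable def branchProd (t : ℂ) : ℂ :=
  72 * t * (t - 2) ^ 2 * (t ^ 2 - t + 1)

theorem eventually_cobounded_ne_zero : ∀ᶠ t in cobounded ℂ, t ≠ 0 :=
  (tendsto_inv₀_cobounded' (α := ℂ)).eventually self_mem_nhdsWithin |>.mono fun _ h => by
    simpa using h

/-- A function of `t` that is near `∞` a function of `1 / t` continuous at `0`. -/
theorem tendsto_cobounded_of_inv {f g : ℂ → ℂ} (hg : ContinuousAt g 0)
    (h : ∀ᶠ t in cobounded ℂ, f t = g t⁻¹) : Tendsto f (cobounded ℂ) (𝓝 (g 0)) :=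
  (hg.tendsto.comp tendsto_inv₀_cobounded).congr' (h.mono fun _ ht => ht.symm)

theorem branchSum_eq {t : ℂ} (ht : t ≠ 0) : branchSum t = t ^ 6 * ((1 - 2 * t⁻¹)
    * (1 - 10 * t⁻¹ + 28 * t⁻¹ ^ 2 - 26 * t⁻¹ ^ 3 + 20 * t⁻¹ ^ 4 + 4 * t⁻¹ ^ 5)) := by
  rw [branchSum]
  field_simp

theorem branchProd_eq {t : ℂ} (ht : t ≠ 0) : branchProd t = t ^ 5 * (72 * (1 - 2 * t⁻¹) ^ 2
    * (1 - t⁻¹ + t⁻¹ ^ 2)) := by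
  rw [branchProd]
  field_simp

theorem eventually_branchSum_ne_zero : ∀ᶠ t in cobounded ℂ, branchSum t ≠ 0 := by
  have h : ContinuousAt (fun s : ℂ => (1 - 2 * s)
      * (1 - 10 * s + 28 * s ^ 2 - 26 * s ^ 3 + 20 * s ^ 4 + 4 * s ^ 5)) 0 := by fun_prop
  filter_upwards [eventually_cobounded_ne_zero,
    tendsto_inv₀_cobounded.eventually (h.eventually_ne (y := 0) (by norm_num))] with t ht hs
  rw [branchSum_eq ht]
  exact mul_ne_zero (pow_ne_zero 6 ht) hs

theorem tendsto_inv_branchSum : Tendsto (fun t => 1 / branchSum t) (cobounded ℂ) (𝓝 0) := by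
  have h := tendsto_cobounded_of_inv (f := fun t => 1 / branchSum t)
    (g := fun s : ℂ => s ^ 6 / ((1 - 2 * s)
      * (1 - 10 * s + 28 * s ^ 2 - 26 * s ^ 3 + 20 * s ^ 4 + 4 * s ^ 5)))
    (ContinuousAt.div (by fun_prop) (by fun_prop) (by norm_num)) (by
      filter_upwards [eventually_cobounded_ne_zero] with t ht
      rw [branchSum_eq ht, ← div_div, one_div, ← inv_pow])
  simpa using h

theorem tendsto_branchProd_div_branchSum :
    Tendsto (fun t => branchProd t / branchSum t) (cobounded ℂ) (𝓝 0) := by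
  have h := tendsto_cobounded_of_inv (f := fun t => branchProd t / branchSum t)
    (g := fun s : ℂ => s * ((72 * (1 - 2 * s) ^ 2 * (1 - s + s ^ 2)) / ((1 - 2 * s)
      * (1 - 10 * s + 28 * s ^ 2 - 26 * s ^ 3 + 20 * s ^ 4 + 4 * s ^ 5))))
    (ContinuousAt.mul (by fun_prop)
      (ContinuousAt.div (by fun_prop) (by fun_prop) (by norm_num))) (by
      filter_upwards [eventually_cobounded_ne_zero] with t ht
      rw [branchSum_eq ht, branchProd_eq ht, mul_div_mul_comm]
      congr 1
      field_simp)
  simpa using h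

/-- The square root `√(1 - 4 P / S ^ 2)` of the normalized discriminant. -/
noncomputable def branchRoot (t : ℂ) : ℂ :=
  (1 - 4 * (branchProd t / branchSum t) * (1 / branchSum t)) ^ (1 / 2 : ℂ)

theorem tendsto_branchDisc : Tendsto
    (fun t => 1 - 4 * (branchProd t / branchSum t) * (1 / branchSum t)) (cobounded ℂ) (𝓝 1) := by
  simpa using ((tendsto_branchProd_div_branchSum.const_mul 4).mul
    tendsto_inv_branchSum).const_sub 1

theorem branchRoot_sq (t : ℂ) :
    branchRoot t ^ 2 = 1 - 4 * (branchProd t / branchSum t) * (1 / branchSum t) := by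
  rw [branchRoot, one_div (2 : ℂ)]
  exact Complex.cpow_nat_inv_pow _ two_ne_zero

theorem tendsto_branchRoot : Tendsto branchRoot (cobounded ℂ) (𝓝 1) := by
  have h : ContinuousAt (fun u : ℂ => u ^ (1 / 2 : ℂ)) 1 :=
    continuousAt_cpow_const Complex.one_mem_slitPlane
  have := h.tendsto.comp tendsto_branchDisc
  rwa [Complex.one_cpow] at this

/-- The numbers `z` and `72 / z'` are the roots of `X² - S X + P`, with `S` of degree `6` and `P` of
degree `5` in `t`. The discriminant divided by `S²` tends to `1`, so its principal square root is
analytic near `∞`. -/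
theorem exists_analytic_branch : ∃ z z' : ℂ → ℂ, IsBranchAtInfinity z z' ∧
    ∀ᶠ t in cobounded ℂ, AnalyticAt ℂ z t ∧ AnalyticAt ℂ z' t := by
  have h2 : Tendsto (fun t => 2 / (1 + branchRoot t)) (cobounded ℂ) (𝓝 (2 / (1 + 1))) :=
    tendsto_const_nhds.div (tendsto_branchRoot.const_add 1) (by norm_num)
  have hne : ∀ᶠ t in cobounded ℂ, 1 + branchRoot t ≠ 0 :=
    (tendsto_branchRoot.const_add 1).eventually_ne (by norm_num)
  -- The large root `S (1 + √) / 2` is taken for `72 / z'`. The small root is written as `P` over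
  -- the large one, which makes its limit visible.
  refine ⟨fun t => branchProd t / branchSum t * (2 / (1 + branchRoot t)),
    fun t => 72 * (1 / branchSum t) * (2 / (1 + branchRoot t)), ⟨?_, ?_, ?_⟩, ?_⟩
  · simpa using tendsto_branchProd_div_branchSum.mul h2
  · simpa using (tendsto_inv_branchSum.const_mul 72).mul h2
  · filter_upwards [hne, eventually_branchSum_ne_zero] with t hr hS
    have hsq := branchRoot_sq t
    have h72 : 72 / (72 * (1 / branchSum t) * (2 / (1 + branchRoot t)))
        = branchSum t * (1 + branchRoot t) / 2 := by
      field_simp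
    refine ⟨mul_ne_zero (mul_ne_zero (by norm_num) (one_div_ne_zero hS))
      (div_ne_zero two_ne_zero hr), ?_, ?_⟩
    · rw [h72]
      change _ = branchSum t
      have h4 : branchProd t = branchSum t ^ 2 * (1 - branchRoot t ^ 2) / 4 := by
        rw [hsq]
        field_simp
        ring
      rw [h4]
      field_simp
      ring
    · rw [h72]
      change _ = branchProd t
      field_simp
  · filter_upwards [hne, eventually_branchSum_ne_zero,
      tendsto_branchDisc.eventually (Complex.isOpen_slitPlane.mem_nhds Complex.one_mem_slitPlane)]
      with t hr hS hD
    have aS : AnalyticAt ℂ branchSum t := by unfold branchSum; fun_prop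
    have aP : AnalyticAt ℂ branchProd t := by unfold branchProd; fun_prop
    have aI : AnalyticAt ℂ (fun t => 1 / branchSum t) t := analyticAt_const.div aS hS
    have aQ : AnalyticAt ℂ (fun t => branchProd t / branchSum t) t := aP.div aS hS
    have aR : AnalyticAt ℂ branchRoot t :=
      (analyticAt_const.sub ((analyticAt_const.mul aQ).mul aI)).cpow analyticAt_const hD
    have a2 : AnalyticAt ℂ (fun t => 2 / (1 + branchRoot t)) t :=
      analyticAt_const.div (analyticAt_const.add aR) hr
    exact ⟨aQ.mul a2, (analyticAt_const.mul aI).mul a2⟩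

/-- Since `w` is a root of the same quadratic, it equals `z` or `72 / z'`. The latter would give `w
* z' = 72`, although this product tends to `0`. -/
theorem IsBranchAtInfinity.eventually_eq {z z' w w' : ℂ → ℂ} (h : IsBranchAtInfinity z z')
    (k : IsBranchAtInfinity w w') : ∀ᶠ t in cobounded ℂ, z t = w t ∧ z' t = w' t := by
  obtain ⟨hz, hz', he⟩ := h
  obtain ⟨kw, -, ke⟩ := k
  have small : ∀ᶠ t in cobounded ℂ, w t * z' t ≠ 72 := by
    have := kw.mul hz'
    rw [mul_zero] at this
    exact this.eventually_ne (by norm_num)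
  filter_upwards [he, ke, small] with t ⟨hz0, hS, hP⟩ ⟨kz0, kS, kP⟩ hs
  have hprod : (w t - z t) * (w t - 72 / z' t) = 0 := by
    linear_combination w t * kS - w t * hS + hP - kP
  have hzw : w t = z t := by
    rcases mul_eq_zero.1 hprod with h1 | h1
    · exact sub_eq_zero.1 h1
    · exact absurd ((eq_div_iff hz0).1 (sub_eq_zero.1 h1)) hs
  refine ⟨hzw.symm, ?_⟩
  have h3 : 72 / z' t = 72 / w' t := by linear_combination hS - kS + hzw
  rw [div_eq_div_iff hz0 kz0] at h3
  exact (mul_left_cancel₀ (by norm_num) h3).symm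

/-! ### The functional equation -/

theorem sextic_functional_equation {z z' : ℂ → ℂ} (h : IsBranchAtInfinity z z') :
    ∀ᶠ t in cobounded ℂ, h6 (z t) =
      6 * (z t ^ 6 / z' t * ((z t + 9) ^ 3 / (z' t + 9) ^ 2)
            * ((z t + 8) ^ 2 / (z' t + 8) ^ 3)) ^ (-(1 / 12) : ℂ)
        * h6 (z' t) := by
  obtain ⟨hz, hz', he⟩ := h
  set G : ℂ → ℂ := fun z => (z + 12) * (z ^ 3 + 252 * z ^ 2 + 3888 * z + 15552) with hG
  set G' : ℂ → ℂ := fun z => (z + 6) * (z ^ 3 + 18 * z ^ 2 + 84 * z + 24) with hG'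
  have tB : Tendsto (fun t => G (z t) ^ 3 / 186624 ^ 3) (cobounded ℂ) (𝓝 1) := by
    have : ContinuousAt (fun z => G z ^ 3 / 186624 ^ 3) 0 := by simp only [hG]; fun_prop
    have := this.tendsto.comp hz
    have h0 : G 0 ^ 3 / 186624 ^ 3 = 1 := by norm_num [hG]
    rwa [h0] at this
  have tB' : Tendsto (fun t => G' (z' t) ^ 3 / 144 ^ 3) (cobounded ℂ) (𝓝 1) := by
    have : ContinuousAt (fun z => G' z ^ 3 / 144 ^ 3) 0 := by simp only [hG']; fun_prop
    have := this.tendsto.comp hz'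
    have h0 : G' 0 ^ 3 / 144 ^ 3 = 1 := by norm_num [hG']
    rwa [h0] at this
  have tq : Tendsto (fun t => G (z t) ^ 3 / 186624 ^ 3 / (G' (z' t) ^ 3 / 144 ^ 3))
      (cobounded ℂ) (𝓝 1) := by
    have := tB.div tB' one_ne_zero
    rwa [div_one] at this
  -- The normalized prefactor base at `z'` and the quotient of the two bases tend to `1`, so near
  -- `∞` principal powers multiply.
  have hre : ∀ᶠ w in 𝓝 (1 : ℂ), 0 < w.re :=
    Complex.continuous_re.continuousAt.eventually_const_lt (by simp)
  have n8 : ∀ᶠ w in 𝓝 (0 : ℂ), w + 8 ≠ 0 := ContinuousAt.eventually_ne (by fun_prop) (by norm_num)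
  have n9 : ∀ᶠ w in 𝓝 (0 : ℂ), w + 9 ≠ 0 := ContinuousAt.eventually_ne (by fun_prop) (by norm_num)
  filter_upwards [he, hz.eventually h6_eq_hypergeometric_fricke,
    hz'.eventually h6_eq_hypergeometric, tB'.eventually hre, tq.eventually hre,
    hz.eventually n8, hz.eventually n9, hz'.eventually n8, hz'.eventually n9,
    tB.eventually_ne one_ne_zero] with t ⟨hz0, hS, hP⟩ e1 e2 r1 r2 m8 m9 m8' m9' hB
  have hmod := modular_invariant_eq hz0 hS hP
  have hGne : G (z t) ≠ 0 := fun h0 => hB (by rw [h0]; simp)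
  have hG'ne : G' (z' t) ≠ 0 := fun h0 => by rw [h0] at r1; simp at r1
  have hx : 1728 * z t ^ 6 * (z t + 9) ^ 3 * (z t + 8) ^ 2 / G (z t) ^ 3
      = 1728 * z' t * (z' t + 9) ^ 2 * (z' t + 8) ^ 3 / G' (z' t) ^ 3 := by
    rw [div_eq_div_iff (pow_ne_zero 3 hGne) (pow_ne_zero 3 hG'ne)]
    linear_combination 1728 * hmod
  -- By the modular identity the bracket is `G(z)³ / G'(z')³`. The values `186624` and `144` of `G`
  -- and `G'` at `0` satisfy `(186624 / 144)³ = 6 ^ 12`.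
  have hM : z t ^ 6 / z' t * ((z t + 9) ^ 3 / (z' t + 9) ^ 2) * ((z t + 8) ^ 2 / (z' t + 8) ^ 3)
      = 6 ^ 12 * (G (z t) ^ 3 / 186624 ^ 3 / (G' (z' t) ^ 3 / 144 ^ 3)) := by
    have : z t ^ 6 / z' t * ((z t + 9) ^ 3 / (z' t + 9) ^ 2)
        * ((z t + 8) ^ 2 / (z' t + 8) ^ 3) = G (z t) ^ 3 / G' (z' t) ^ 3 := by
      rw [div_mul_div_comm, div_mul_div_comm, div_eq_div_iff
        (mul_ne_zero (mul_ne_zero hz0 (pow_ne_zero 2 m9')) (pow_ne_zero 3 m8'))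
        (pow_ne_zero 3 hG'ne)]
      linear_combination hmod
    rw [this]
    field_simp
    norm_num
  have hq0 : G (z t) ^ 3 / 186624 ^ 3 / (G' (z' t) ^ 3 / 144 ^ 3) ≠ 0 := by
    intro h0
    rw [h0] at r2
    simp at r2
  have hb0 : G' (z' t) ^ 3 / 144 ^ 3 ≠ 0 := by
    intro h0
    rw [h0] at r1
    simp at r1
  rw [e1, e2, hM, six_mul_cpow hq0, ← mul_assoc, ← mul_cpow_of_re_pos r2 r1,
    div_mul_cancel₀ _ hb0]
  exact congrArg _ (congrArg _ hx)

theorem mainTheorem4 :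
    -- the power series defining `h6` converges near `0`
    (∀ᶠ z in 𝓝 (0 : ℂ), Summable fun n : ℕ => h6Coeff n * z ^ n) ∧
    -- the equivalent definition of `h6` through the Gauss hypergeometric function
    (∀ᶠ z in 𝓝 (0 : ℂ), h6 z =
      (1 / (2 ^ 12 * 3 ^ 6) * (z + 6) ^ 3 * (z ^ 3 + 18 * z ^ 2 + 84 * z + 24) ^ 3)
          ^ (-(1 / 12) : ℂ)
        * ordinaryHypergeometric (1 / 12 : ℂ) (5 / 12 : ℂ) (1 : ℂ)
          (1728 * z * (z + 9) ^ 2 * (z + 8) ^ 3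
            / ((z + 6) ^ 3 * (z ^ 3 + 18 * z ^ 2 + 84 * z + 24) ^ 3))) ∧
    -- the equivalent definition of `h6` through the local Heun function
    (∀ Hl : ℂ → ℂ, IsLocalHeun (9 / 8) (3 / 4) 1 1 1 1 Hl ↔
      ∀ᶠ z in 𝓝 (0 : ℂ), h6 z = Hl (-z / 8)) ∧
    -- the branch exists, as a pair of functions analytic near `∞`, and is unique near `∞`
    (∃ z z' : ℂ → ℂ, IsBranchAtInfinity z z' ∧
      ∀ᶠ t in cobounded ℂ, AnalyticAt ℂ z t ∧ AnalyticAt ℂ z' t) ∧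
    (∀ z z' w w' : ℂ → ℂ, IsBranchAtInfinity z z' → IsBranchAtInfinity w w' →
      ∀ᶠ t in cobounded ℂ, z t = w t ∧ z' t = w' t) ∧
    -- the sextic functional equation
    (∀ z z' : ℂ → ℂ, IsBranchAtInfinity z z' →
      ∀ᶠ t in cobounded ℂ,
        h6 (z t) =
          6 * (z t ^ 6 / z' t * ((z t + 9) ^ 3 / (z' t + 9) ^ 2)
                * ((z t + 8) ^ 2 / (z' t + 8) ^ 3)) ^ (-(1 / 12) : ℂ)
            * h6 (z' t)) := by
  refine ⟨?_, ?_, isLocalHeun_iff, exists_analytic_branch, fun z z' w w' h k => h.eventually_eq k,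
    fun z z' h => sextic_functional_equation h⟩
  · filter_upwards [eventually_norm_lt_one] with z hz
    exact (hasSum_euler_derivatives norm_h6Coeff_le_one (f := h6) (fun _ => rfl) hz).2.1.summable
  · filter_upwards [h6_eq_hypergeometric] with z hz
    rw [hz]
    congr 2
    · ring
    · rw [mul_pow]
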